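/- Let $g\ge 1$ and let $\Gamma$ be a chain of $g$ loops connected by bridges, i.e. the metric graph with vertices $v_1,w_1,\dots,v_g,w_g$ and the following edges: for each $1\le i\le g$ two edges joining $v_i$ to $w_i$, of lengths $\ell_i>0$ and $m_i>0$ (together forming the $i$th loop), and for each $1\le i\le g-1$ a bridge of length $b_i>0$ joining $w_i$ to $v_{i+1}$. For each $i$ let the cell $\gamma_i$ be the $i$th loop minus the point $w_i$. A divisor on $\Gamma$ is a finite formal $\mathbb{Z}$-linear combination of points of $\Gamma$; it is effective if all its coefficients are nonnegative, and an effective divisor contains a point if the coefficient of that point is positive. For a continuous piecewise linear function $\psi$ on $\Gamma$ with integer slopes, $\operatorname{div}(\psi)=\sum_{p\in\Gamma}\operatorname{ord}_p(\psi)\,p$, where $\operatorname{ord}_p(\psi)$ is the sum of the incoming slopes of $\psi$ at $p$ along the edges containing $p$; two divisors are equivalent if their difference is of the form $\operatorname{div}(\psi)$. The canonical divisor is $K_\Gamma=\sum_{p\in\Gamma}(\deg(p)-2)\,p$, where $\deg(p)$ is the valence of $p$. Let $D$ be an effective divisor on $\Gamma$ equivalent to $K_\Gamma$. Then $D$ contains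 no point of at least one of the cells $\gamma_1,\dots,\gamma_g$. -/

import Mathlib

open Set

noncomputable section

/-- A (finite, compact) metric graph, presented by finitely many vertices `V` and finitely many
edges `E`; the edge `e` is a closed segment of length `length e > 0` whose end at parameter `0` is
glued to `src e` and whose end at parameter `length e` is glued to `tgt e`. Multiple edges are
allowed. -/
structure MetricGraph (V E : Type*) where
  src : E → V
  tgt : E → V
  length : E → ℝ
  length_pos : ∀ e, 0 < length e

namespace MetricGraph

variable {V E : Type*}

/-- The points of the metric graph: the vertices, and for each edge `e` the points of the open
edge, parametrized by their distance `t ∈ (0, length e)` from the end `src e`. -/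
inductive Point (Γ : MetricGraph V E) : Type _
  | vertex (x : V) : Point Γ
  | inner (e : E) (t : Ioo (0 : ℝ) (Γ.length e)) : Point Γ

/-- The parametrization `[0, length e] → Γ` of the closed edge `e` by arc length from `src e`,
extended by constants outside of `[0, length e]`. -/
def param (Γ : MetricGraph V E) (e : E) (t : ℝ) : Γ.Point :=
  if h₀ : 0 < t then
    if h₁ : t < Γ.length e then .inner e ⟨t, h₀, h₁⟩ else .vertex (Γ.tgt e)
  else .vertex (Γ.src e)

/-- `f` is continuous and piecewise linear with integer slopes on `[0, L]`: there is a
subdivision `0 = t 0 ≤ t 1 ≤ ⋯ ≤ t n = L` such that `f` is affine with an integer slope on each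
closed interval `[t k, t (k + 1)]`. -/
def IsPLOn (f : ℝ → ℝ) (L : ℝ) : Prop :=
  ∃ (n : ℕ) (t : ℕ → ℝ), Monotone t ∧ t 0 = 0 ∧ t n = L ∧
    ∀ k < n, ∃ m : ℤ, ∀ x ∈ Icc (t k) (t (k + 1)), f x = f (t k) + m * (x - t k)

/-- `PL(Γ)`: continuous piecewise linear functions with integer slopes on `Γ`. (The closed edges
are glued at the vertices, so continuity on `Γ` is continuity on each closed edge.) -/
def IsPL (Γ : MetricGraph V E) (ψ : Γ.Point → ℝ) : Prop :=
  ∀ e, IsPLOn (fun t => ψ (Γ.param e t)) (Γ.length e)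

/-- The incoming slope of `ψ` at the point of `e` with parameter `t`, arriving along `e` in the
direction of increasing parameter. -/
def slopeFromLeft (Γ : MetricGraph V E) (ψ : Γ.Point → ℝ) (e : E) (t : ℝ) : ℝ :=
  derivWithin (fun s => ψ (Γ.param e s)) (Iic t) t

/-- The incoming slope of `ψ` at the point of `e` with parameter `t`, arriving along `e` in the
direction of decreasing parameter. -/
def slopeFromRight (Γ : MetricGraph V E) (ψ : Γ.Point → ℝ) (e : E) (t : ℝ) : ℝ :=
  - derivWithin (fun s => ψ (Γ.param e s)) (Ici t) t

open Classical in
/-- The order of `ψ` at a point: the sum of its incoming slopes along all edge germs there. (For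
`ψ ∈ PL(Γ)` this real number is an integer.) An edge with both ends at `x` contributes twice. -/
def ord (Γ : MetricGraph V E) [Fintype E] (ψ : Γ.Point → ℝ) : Γ.Point → ℝ
  | .vertex x =>
      (∑ e : E, if Γ.src e = x then Γ.slopeFromRight ψ e 0 else 0) +
      (∑ e : E, if Γ.tgt e = x then Γ.slopeFromLeft ψ e (Γ.length e) else 0)
  | .inner e t => Γ.slopeFromLeft ψ e t + Γ.slopeFromRight ψ e t

/-- Divisors: finite formal integer combinations of points. -/
abbrev Divisor (Γ : MetricGraph V E) : Type _ := Γ.Point →₀ ℤ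

/-- A divisor is effective if all of its coefficients are nonnegative. -/
def IsEffective {Γ : MetricGraph V E} (D : Γ.Divisor) : Prop := ∀ p, 0 ≤ D p

/-- An effective divisor contains `p` if the coefficient of `p` is strictly positive. -/
def Contains {Γ : MetricGraph V E} (D : Γ.Divisor) (p : Γ.Point) : Prop := 0 < D p

/-- `D` is principal: `D = div ψ` for some `ψ ∈ PL(Γ)`. -/
def IsPrincipal {Γ : MetricGraph V E} [Fintype E] (D : Γ.Divisor) : Prop :=
  ∃ ψ : Γ.Point → ℝ, Γ.IsPL ψ ∧ ∀ p, (D p : ℝ) = Γ.ord ψ p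

/-- Equivalence of divisors. -/
def Equivalent {Γ : MetricGraph V E} [Fintype E] (D D' : Γ.Divisor) : Prop :=
  IsPrincipal (D - D')

open Classical in
/-- The valence of a point: the number of edge germs there. -/
def valence (Γ : MetricGraph V E) [Fintype E] : Γ.Point → ℕ
  | .vertex x => (Finset.univ.filter fun e => Γ.src e = x).card +
      (Finset.univ.filter fun e => Γ.tgt e = x).card
  | .inner _ _ => 2

open Classical in
/-- The canonical divisor `K_Γ = ∑ p, (valence p - 2) p`. -/
def canonicalDivisor (Γ : MetricGraph V E) [Fintype V] [Fintype E] : Γ.Divisor :=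
  Finsupp.onFinset (Finset.univ.image Point.vertex) (fun p => (Γ.valence p : ℤ) - 2) (by
    rintro (x | ⟨e, t⟩) h
    · simp
    · simp [valence] at h)

end MetricGraph

namespace ChainOfLoops

/-- The vertices `v_1, …, v_g` and `w_1, …, w_g`. -/
abbrev Vertex (g : ℕ) : Type := Fin g ⊕ Fin g

/-- The edges: the two edges of each of the `g` loops, and the `g - 1` bridges. -/
abbrev Edge (g : ℕ) : Type := (Fin g ⊕ Fin g) ⊕ Fin (g - 1)

variable {g : ℕ}

/-- The left vertex of loop `i`. -/
abbrev v (i : Fin g) : Vertex g := .inl i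

/-- The right vertex of loop `i`. -/
abbrev w (i : Fin g) : Vertex g := .inr i

/-- The first edge of loop `i`. -/
abbrev top (i : Fin g) : Edge g := .inl (.inl i)

/-- The second edge of loop `i`. -/
abbrev bottom (i : Fin g) : Edge g := .inl (.inr i)

/-- The bridge between two consecutive loops. -/
abbrev bridge (i : Fin (g - 1)) : Edge g := .inr i

/-- The chain of `g` loops with bridges: loop `i` consists of two edges from `v i` to `w i`, of
lengths `l i` and `m i`; bridge `i` is an edge from `w i` to `v (i + 1)`, of length `b i`. -/
def graph (l m : Fin g → ℝ) (b : Fin (g - 1) → ℝ)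
    (hl : ∀ i, 0 < l i) (hm : ∀ i, 0 < m i) (hb : ∀ i, 0 < b i) :
    MetricGraph (Vertex g) (Edge g) where
  src
    | .inl (.inl i) => v i
    | .inl (.inr i) => v i
    | .inr i => w ⟨i, by omega⟩
  tgt
    | .inl (.inl i) => w i
    | .inl (.inr i) => w i
    | .inr i => v ⟨i + 1, by omega⟩
  length
    | .inl (.inl i) => l i
    | .inl (.inr i) => m i
    | .inr i => b i
  length_pos := by
    rintro ((i | i) | i)
    · exact hl i
    · exact hm i
    · exact hb i

/-- The `i`-th loop, as a set of points. -/
def loop (l m : Fin g → ℝ) (b : Fin (g - 1) → ℝ)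
    (hl : ∀ i, 0 < l i) (hm : ∀ i, 0 < m i) (hb : ∀ i, 0 < b i) (i : Fin g) :
    Set (graph l m b hl hm hb).Point :=
  (graph l m b hl hm hb).param (top i) '' Icc 0 (l i) ∪
    (graph l m b hl hm hb).param (bottom i) '' Icc 0 (m i)

/-- The cell `γ_i`: the `i`-th loop minus the point `w_i`. -/
def cell (l m : Fin g → ℝ) (b : Fin (g - 1) → ℝ)
    (hl : ∀ i, 0 < l i) (hm : ∀ i, 0 < m i) (hb : ∀ i, 0 < b i) (i : Fin g) :
    Set (graph l m b hl hm hb).Point :=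
  loop l m b hl hm hb i \ {.vertex (w i)}

end ChainOfLoops

end

/-! Let `D - K = div ψ` and suppose that every cell contains a chip of `D`. Inside edges `K`
vanishes and `D ≥ 0`, so `ψ` is concave along each edge (`IsPL.edge_bounds`). The invariant carried
from left to right is that the slopes of `ψ` arriving at `w i` along loop `i` have sum at most `-2`.
Effectiveness at `w i`, where `K` has coefficient 1 if a bridge leaves, then forces slope at most
`-1` onto that bridge. Concavity preserves this bound up to the next `v`, where it cancels the
coefficient of `K`, so the slopes entering the next loop have sum at most 0. By `circle_slopes_le`
the invariant recurs unless `ψ` is constant on that loop, which the chip in its cell excludes. At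
the last `w` no bridge leaves, and `D` would be negative there. -/

namespace MetricGraph

/-- A piecewise linear function with integer slopes whose slopes do not increase at interior points
lies between its initial and its final tangent; if it attains the bound given by the initial
tangent, it has no break. -/
theorem IsPLOn.concave_bounds {f : ℝ → ℝ} {L : ℝ} (hL : 0 < L) (hf : IsPLOn f L)
    (hc : ∀ y ∈ Ioo 0 L, derivWithin f (Ici y) y ≤ derivWithin f (Iic y) y) :
    ∃ a a' : ℤ, derivWithin f (Ici 0) 0 = a ∧ derivWithin f (Iic L) L = a' ∧
      a' * L ≤ f L - f 0 ∧ f L - f 0 ≤ a * L ∧ a' ≤ a ∧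
      (f L - f 0 = a * L →
        ∀ y ∈ Ioo 0 L, derivWithin f (Ici y) y = derivWithin f (Iic y) y) := by
  obtain ⟨n, t, hmono, h0, hn, hslope⟩ := hf
  have right_deriv : ∀ {x x' : ℝ} {m : ℤ}, (∀ z ∈ Icc x x', f z = f x + m * (z - x)) →
      ∀ y ∈ Ico x x', derivWithin f (Ici y) y = m := by
    intro x x' m h y hy
    have hd : HasDerivWithinAt (fun z => f x + m * (z - x)) (m : ℝ) (Ici y) y := by
      simpa using ((((hasDerivAt_id y).sub_const x).const_mul (m : ℝ)).const_add
        (f x)).hasDerivWithinAt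
    refine (hd.congr_of_eventuallyEq ?_ (h y ⟨hy.1, hy.2.le⟩)).derivWithin
      (uniqueDiffWithinAt_Ici y)
    filter_upwards [Icc_mem_nhdsGE hy.2] with z hz
    exact h z ⟨hy.1.trans hz.1, hz.2⟩
  have left_deriv : ∀ {x x' : ℝ} {m : ℤ}, (∀ z ∈ Icc x x', f z = f x + m * (z - x)) →
      ∀ y ∈ Ioc x x', derivWithin f (Iic y) y = m := by
    intro x x' m h y hy
    have hd : HasDerivWithinAt (fun z => f x + m * (z - x)) (m : ℝ) (Iic y) y := by
      simpa using ((((hasDerivAt_id y).sub_const x).const_mul (m : ℝ)).const_add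
        (f x)).hasDerivWithinAt
    refine (hd.congr_of_eventuallyEq ?_ (h y ⟨hy.1.le, hy.2⟩)).derivWithin
      (uniqueDiffWithinAt_Iic y)
    filter_upwards [Icc_mem_nhdsLE hy.1] with z hz
    exact h z ⟨hz.1, hz.2.trans hy.2⟩
  -- Breakpoints may repeat, so an initial run of them can sit at 0, where there is no piece to
  -- speak of yet.
  have key : ∀ k ≤ n, t k = 0 ∨ ∃ a a' : ℤ, derivWithin f (Ici 0) 0 = a ∧
      derivWithin f (Iic (t k)) (t k) = a' ∧
      a' * t k ≤ f (t k) - f 0 ∧ f (t k) - f 0 ≤ a * t k ∧ a' ≤ a ∧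
      (f (t k) - f 0 = a * t k →
        a' = a ∧ ∀ y ∈ Ioo 0 (t k), derivWithin f (Ici y) y = derivWithin f (Iic y) y) := by
    intro k
    induction k with
    | zero => exact fun _ => Or.inl h0
    | succ k ih =>
      intro hk
      have ih := ih (by omega)
      rcases (hmono (Nat.le_succ k)).eq_or_lt with heq | hlt
      · rw [Nat.succ_eq_add_one] at heq
        rwa [← heq]
      · obtain ⟨m, hm⟩ := hslope k (by omega)
        rw [Nat.succ_eq_add_one] at hlt
        have hend := hm (t (k + 1)) ⟨hlt.le, le_rfl⟩
        have hrd := right_deriv hm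
        have hld := left_deriv hm
        right
        rcases (h0 ▸ hmono (Nat.zero_le k) : 0 ≤ t k).eq_or_lt with hz | hpos
        · rw [← hz] at hend hrd hld hlt
          refine ⟨m, m, hrd 0 ⟨le_rfl, hlt⟩, hld _ ⟨hlt, le_rfl⟩, by linarith, by linarith,
            le_rfl, fun _ => ⟨rfl, fun y hy => ?_⟩⟩
          rw [hrd y ⟨hy.1.le, hy.2⟩, hld y ⟨hy.1, hy.2.le⟩]
        · obtain ⟨a, a', ha, ha', hlow, hup, haa, heq⟩ := ih.resolve_left hpos.ne'
          have hkL : t k < L := hlt.trans_le (hn ▸ hmono hk)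
          have hrk := hrd (t k) ⟨le_rfl, hlt⟩
          have hma : (m : ℝ) ≤ a' := by
            have := hc (t k) ⟨hpos, hkL⟩
            rwa [hrk, ha'] at this
          have haa' : (a' : ℝ) ≤ a := by exact_mod_cast haa
          refine ⟨a, m, ha, hld _ ⟨hlt, le_rfl⟩, by nlinarith, by nlinarith,
            by exact_mod_cast hma.trans haa', fun h => ?_⟩
          -- A last piece of slope below `a` has positive length, so it would drop strictly below
          -- the initial tangent.
          have hma' : (m : ℝ) = a := by
            by_contra hne
            have : (m : ℝ) < a := lt_of_le_of_ne (hma.trans haa') hne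
            nlinarith
          obtain ⟨-, hold⟩ := heq (by rw [hma'] at hend; linarith)
          refine ⟨by exact_mod_cast hma', fun y hy => ?_⟩
          rcases lt_trichotomy y (t k) with hy' | rfl | hy'
          · exact hold y ⟨hy.1, hy'⟩
          · rw [hrk, ha']; linarith
          · rw [hrd y ⟨hy'.le, hy.2⟩, hld y ⟨hy', hy.2.le⟩]
  rcases key n le_rfl with h | ⟨a, a', h⟩
  · exact absurd (hn ▸ h) hL.ne'
  · rw [hn] at h
    exact ⟨a, a', h.1, h.2.1, h.2.2.1, h.2.2.2.1, h.2.2.2.2.1, fun he => (h.2.2.2.2.2 he).2⟩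

variable {V E : Type*} (Γ : MetricGraph V E)

theorem param_zero (e : E) : Γ.param e 0 = .vertex (Γ.src e) := by simp [param]

theorem param_length (e : E) : Γ.param e (Γ.length e) = .vertex (Γ.tgt e) := by
  simp [param, Γ.length_pos e]

/-- The data of a piecewise linear function on an edge in whose interior all its orders are
nonnegative: its integral slopes `a` and `a'` at the two ends compared with its total increment. -/
theorem IsPL.edge_bounds {Γ : MetricGraph V E} [Fintype E] {ψ : Γ.Point → ℝ} (hψ : Γ.IsPL ψ) (e : E)
    (hc : ∀ t, 0 ≤ Γ.ord ψ (.inner e t)) :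
    ∃ a a' : ℤ, Γ.slopeFromRight ψ e 0 = -a ∧ Γ.slopeFromLeft ψ e (Γ.length e) = a' ∧
      a' * Γ.length e ≤ ψ (.vertex (Γ.tgt e)) - ψ (.vertex (Γ.src e)) ∧
      ψ (.vertex (Γ.tgt e)) - ψ (.vertex (Γ.src e)) ≤ a * Γ.length e ∧ a' ≤ a ∧
      (ψ (.vertex (Γ.tgt e)) - ψ (.vertex (Γ.src e)) = a * Γ.length e →
        ∀ t, Γ.ord ψ (.inner e t) = 0) := by
  obtain ⟨a, a', h1, h2, h3, h4, h5, h6⟩ := (hψ e).concave_bounds (Γ.length_pos e) (by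
    intro y hy
    have := hc ⟨y, hy⟩
    simp only [ord, slopeFromLeft, slopeFromRight] at this
    linarith)
  simp only [param_zero, param_length] at h3 h4 h6
  refine ⟨a, a', by rw [slopeFromRight, h1], h2, h3, h4, h5, fun he t => ?_⟩
  have := h6 he t t.2
  simp only [ord, slopeFromLeft, slopeFromRight]
  linarith

end MetricGraph

namespace ChainOfLoops

open MetricGraph

/-- On a circle made of two arcs of lengths `L` and `M` from `v` to `w`, a function which is
concave away from `w`, with slopes `a`, `b` leaving `v` and `a'`, `b'` arriving at `w`, has order
at most `-2` at `w`, unless it is constant: a divisor `p - w` with `p ≠ w` is not principal. -/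
theorem circle_slopes_le {L M c : ℝ} (hL : 0 < L) (hM : 0 < M) {a a' b b' : ℤ}
    (ha' : a' * L ≤ c) (ha : c ≤ a * L) (hb' : b' * M ≤ c) (hb : c ≤ b * M) (hab : a + b ≤ 0)
    (hne : ¬ (a + b = 0 ∧ c = a * L ∧ c = b * M)) : a' + b' ≤ -2 := by
  have pos_of : ∀ {n : ℤ} {K : ℝ}, 0 < K → 0 < (n : ℝ) * K → 0 < n := fun hK h => by
    exact_mod_cast pos_of_mul_pos_left h hK.le
  have neg_of : ∀ {n : ℤ} {K : ℝ}, 0 < K → (n : ℝ) * K < 0 → n < 0 := fun hK h => by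
    exact_mod_cast neg_of_mul_neg_left h hK.le
  have nonneg_of : ∀ {n : ℤ} {K : ℝ}, 0 < K → 0 ≤ (n : ℝ) * K → 0 ≤ n := fun hK h => by
    exact_mod_cast nonneg_of_mul_nonneg_left h hK
  -- If `c < 0`, both arriving slopes are negative integers, hence at most `-1` each. If `c ≥ 0`,
  -- the leaving slopes have the sign of `c`, which `hab` and `hne` exclude.
  rcases lt_trichotomy c 0 with hc | rfl | hc
  · have := neg_of hL (ha'.trans_lt hc)
    have := neg_of hM (hb'.trans_lt hc)
    omega
  · have h1 := nonneg_of hL ha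
    have h2 := nonneg_of hM hb
    obtain ⟨rfl, rfl⟩ : a = 0 ∧ b = 0 := by omega
    simp at hne
  · have := pos_of hL (hc.trans_le ha)
    have := pos_of hM (hc.trans_le hb)
    omega

variable {g : ℕ} {l m : Fin g → ℝ} {b : Fin (g - 1) → ℝ}
  {hl : ∀ i, 0 < l i} {hm : ∀ i, 0 < m i} {hb : ∀ i, 0 < b i}

/-- The sum has at most one nonzero term; it is empty of such terms at the first loop, which thus
needs no separate formula. -/
theorem ord_v (ψ : (graph l m b hl hm hb).Point → ℝ) (i : Fin g) :
    (graph l m b hl hm hb).ord ψ (.vertex (v i)) =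
      (graph l m b hl hm hb).slopeFromRight ψ (top i) 0 +
      (graph l m b hl hm hb).slopeFromRight ψ (bottom i) 0 +
      ∑ j : Fin (g - 1), if (j : ℕ) + 1 = i then
        (graph l m b hl hm hb).slopeFromLeft ψ (bridge j) (b j) else 0 := by
  simp [ord, graph, Fin.ext_iff]
  simp [← Fin.ext_iff]

theorem ord_w (ψ : (graph l m b hl hm hb).Point → ℝ) (i : Fin g) :
    (graph l m b hl hm hb).ord ψ (.vertex (w i)) =
      (∑ j : Fin (g - 1), if (j : ℕ) = i then
        (graph l m b hl hm hb).slopeFromRight ψ (bridge j) 0 else 0) +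
      ((graph l m b hl hm hb).slopeFromLeft ψ (top i) (l i) +
      (graph l m b hl hm hb).slopeFromLeft ψ (bottom i) (m i)) := by
  simp [ord, graph, Fin.ext_iff]
  simp [← Fin.ext_iff]

theorem canonicalDivisor_v (i : Fin g) :
    (graph l m b hl hm hb).canonicalDivisor (.vertex (v i)) =
      ∑ j : Fin (g - 1), if (j : ℕ) + 1 = i then 1 else 0 := by
  simp only [canonicalDivisor, Finsupp.onFinset_apply, valence, Finset.card_filter,
    Fintype.sum_sum_type]
  simp [graph, Fin.ext_iff]
  simp [← Fin.ext_iff, Finset.filter_eq']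

theorem canonicalDivisor_w (i : Fin g) :
    (graph l m b hl hm hb).canonicalDivisor (.vertex (w i)) =
      ∑ j : Fin (g - 1), if (j : ℕ) = i then 1 else 0 := by
  simp only [canonicalDivisor, Finsupp.onFinset_apply, valence, Finset.card_filter,
    Fintype.sum_sum_type]
  simp [graph, Fin.ext_iff]
  simp [← Fin.ext_iff, Finset.filter_eq']

theorem canonicalDivisor_inner (e : Edge g) (t) :
    (graph l m b hl hm hb).canonicalDivisor (.inner e t) = 0 := by
  simp [canonicalDivisor, valence]

theorem mem_cell {i : Fin g} {p : (graph l m b hl hm hb).Point}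
    (hp : p ∈ cell l m b hl hm hb i) :
    p = .vertex (v i) ∨ (∃ t, p = .inner (top i) t) ∨ ∃ t, p = .inner (bottom i) t := by
  obtain ⟨⟨t, -, rfl⟩ | ⟨t, -, rfl⟩, hw⟩ := hp
  all_goals
    simp only [param, mem_singleton_iff] at hw ⊢
    split_ifs at hw ⊢ with h₀ h₁
    · simp
    · exact absurd rfl hw
    · exact Or.inl rfl

end ChainOfLoops

/-! ### Propagating slopes along the chain. -/

open MetricGraph ChainOfLoops in
theorem mainTheorem4 (g : ℕ) (hg : 1 ≤ g)
    (l m : Fin g → ℝ) (b : Fin (g - 1) → ℝ)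
    (hl : ∀ i, 0 < l i) (hm : ∀ i, 0 < m i) (hb : ∀ i, 0 < b i)
    (D : (ChainOfLoops.graph l m b hl hm hb).Divisor)
    (hD : MetricGraph.IsEffective D)
    (hK : MetricGraph.Equivalent D (ChainOfLoops.graph l m b hl hm hb).canonicalDivisor) :
    ∃ i : Fin g, ∀ p ∈ ChainOfLoops.cell l m b hl hm hb i, ¬ MetricGraph.Contains D p := by
  by_contra! hcon
  obtain ⟨ψ, hψ, hord⟩ := hK
  have hinner : ∀ e t, (graph l m b hl hm hb).ord ψ (.inner e t) = D (.inner e t) := by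
    intro e t
    rw [← hord, Finsupp.sub_apply, canonicalDivisor_inner, sub_zero]
  choose a a' hsr hsl hlow hup haa hstrict using fun e => hψ.edge_bounds e (fun t => by
    rw [hinner]; exact_mod_cast hD _)
  have hslt : ∀ i, (graph l m b hl hm hb).slopeFromLeft ψ (top i) (l i) = a' (top i) :=
    fun i => hsl (top i)
  have hslb : ∀ i, (graph l m b hl hm hb).slopeFromLeft ψ (bottom i) (m i) = a' (bottom i) :=
    fun i => hsl (bottom i)
  have hslr : ∀ i, (graph l m b hl hm hb).slopeFromLeft ψ (bridge i) (b i) = a' (bridge i) :=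
    fun i => hsl (bridge i)
  -- the orders at the vertices, as identities between integers
  have hv : ∀ i : Fin g, D (.vertex (v i)) = -(a (top i) + a (bottom i)) +
      ∑ j : Fin (g - 1), if (j : ℕ) + 1 = i then a' (bridge j) + 1 else 0 := by
    intro i
    have h := hord (.vertex (v i))
    rw [Finsupp.sub_apply, canonicalDivisor_v, ord_v, hsr, hsr] at h
    simp only [hslr] at h
    have h' : D (.vertex (v i)) - (∑ j : Fin (g - 1), if (j : ℕ) + 1 = i then (1 : ℤ) else 0) =
        -a (top i) + -a (bottom i) +
        ∑ j : Fin (g - 1), if (j : ℕ) + 1 = i then a' (bridge j) else 0 := by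
      exact_mod_cast h
    rw [sub_eq_iff_eq_add, add_assoc, ← Finset.sum_add_distrib] at h'
    rw [h', neg_add]
    congr 1
    exact Finset.sum_congr rfl fun j _ => by split_ifs <;> simp
  have hw : ∀ i : Fin g, D (.vertex (w i)) = (a' (top i) + a' (bottom i)) +
      ∑ j : Fin (g - 1), if (j : ℕ) = i then 1 - a (bridge j) else 0 := by
    intro i
    have h := hord (.vertex (w i))
    rw [Finsupp.sub_apply, canonicalDivisor_w, ord_w, hslt, hslb] at h
    simp only [hsr] at h
    have h' : D (.vertex (w i)) - (∑ j : Fin (g - 1), if (j : ℕ) = i then (1 : ℤ) else 0) =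
        (∑ j : Fin (g - 1), if (j : ℕ) = i then -a (bridge j) else 0) +
        (a' (top i) + a' (bottom i)) := by
      exact_mod_cast h
    rw [sub_eq_iff_eq_add, add_comm (Finset.sum _ _) (_ + _), add_assoc,
      ← Finset.sum_add_distrib] at h'
    rw [h']
    congr 1
    exact Finset.sum_congr rfl fun j _ => by split_ifs <;> ring
  -- a chip in the cell forces total slope at most `-2` into `w i`
  have hloop : ∀ i : Fin g, D (.vertex (v i)) ≤ -(a (top i) + a (bottom i)) →
      a' (top i) + a' (bottom i) ≤ -2 := by
    intro i hi
    have hvi := hD (.vertex (v i))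
    refine circle_slopes_le (hl i) (hm i) (hlow (top i)) (hup (top i)) (hlow (bottom i))
      (hup (bottom i)) (by omega) ?_
    rintro ⟨h0, ht, hbt⟩
    obtain ⟨p, hp, hpD⟩ := hcon i
    have hpD : 0 < D p := hpD
    -- In the exceptional case `D` vanishes at `v i`, and `ψ` has no break inside either arc, so the
    -- chip has nowhere to lie.
    rcases mem_cell hp with rfl | ⟨t, rfl⟩ | ⟨t, rfl⟩
    · omega
    · have := hstrict (top i) ht t
      rw [hinner] at this
      exact hpD.ne' (by exact_mod_cast this)
    · have := hstrict (bottom i) hbt t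
      rw [hinner] at this
      exact hpD.ne' (by exact_mod_cast this)
  have hall : ∀ (k : ℕ) (hk : k < g), a' (top ⟨k, hk⟩) + a' (bottom ⟨k, hk⟩) ≤ -2 := by
    intro k
    induction k with
    | zero =>
      intro hk
      apply hloop
      -- No bridge arrives at the first `v`, so the bound is an equality.
      rw [hv]
      simp
    | succ k ih =>
      intro hk
      have hprev := ih (by omega)
      have hk' : k < g - 1 := by omega
      apply hloop
      have hwk := hw ⟨k, by omega⟩
      have hDw := hD (.vertex (w ⟨k, by omega⟩))
      rw [Finset.sum_eq_single ⟨k, hk'⟩ (fun j _ hj => if_neg fun h => hj (Fin.ext h))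
        (by simp), if_pos rfl] at hwk
      rw [hv, Finset.sum_eq_single ⟨k, hk'⟩
        (fun j _ hj => if_neg fun h => hj (Fin.ext (by simpa using h))) (by simp), if_pos rfl]
      -- `0 ≤ D (w k) ≤ -2 + 1 - a` gives `a ≤ -1` on the bridge, and `a' ≤ a` gives `a' + 1 ≤ 0`.
      have := haa (bridge ⟨k, hk'⟩)
      omega
  have hlast := hall (g - 1) (by omega)
  have hwg := hw ⟨g - 1, by omega⟩
  have hDw := hD (.vertex (w ⟨g - 1, by omega⟩))
  -- No bridge has index `g - 1`, so `D` at the last `w` equals a slope sum that is at most `-2`.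
  rw [Finset.sum_eq_zero fun j _ => if_neg j.2.ne] at hwg
  omega
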